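/- Let $E$ be a nonzero real Banach space with dual $E^*$, and let $S\colon E \rightrightarrows E^*$ be a multifunction with nonempty graph $G(S)=\{(s,s^*)\in E\times E^*: s^*\in S(s)\}$. Suppose that $S$ is closed (that is, $G(S)$ is norm-closed in $E\times E^*$) and monotone (that is, $\langle s-t,s^*-t^*\rangle\ge 0$ for all $(s,s^*),(t,t^*)\in G(S)$). Then the following conditions are equivalent: (a) $S$ is quasidense, that is, for all $(x,x^*)\in E\times E^*$, $$\inf_{(s,s^*)\in G(S)}\Big[\tfrac12\|s-x\|^2+\tfrac12\|s^*-x^*\|^2+\langle s-x,s^*-x^*\rangle\Big]\le 0.$$ (b) For every $w\in E$, every nonempty weak$^*$-compact convex subset $\widetilde W$ of $E^*$ and every $\eta>0$, there exists $(s,s^*)\in G(S)$ such that $$\tfrac12\|s-w\|^2+\tfrac12\,\mathrm{dist}(s^*,\widetilde W)^2+\max_{w^*\in\widetilde W}\langle s-w,s^*-w^*\rangle<\eta,$$ where $\mathrm{dist}(s^*,\widetilde W)=\inf_{w^*\in\widetilde W}\|s^*-w^*\|$. -/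

import Mathlib

namespace Multifunction

variable {E : Type*} [NormedAddCommGroup E] [NormedSpace ℝ E]

/-- The graph of a multifunction from `E` into its (norm) dual, as a subset of `E × E*`. -/
def graph (S : E → Set (StrongDual ℝ E)) : Set (E × StrongDual ℝ E) :=
  {p | p.2 ∈ S p.1}

/-- The multifunction is closed: its graph is closed for the norm topology of `E × E*`. -/
def IsClosedGraph (S : E → Set (StrongDual ℝ E)) : Prop :=
  IsClosed (graph S)

/-- The multifunction is monotone: `⟨x - y, x* - y*⟩ ≥ 0` for all `(x, x*)` and `(y, y*)` in the
graph. -/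
def IsMonotone (S : E → Set (StrongDual ℝ E)) : Prop :=
  ∀ p ∈ graph S, ∀ q ∈ graph S, 0 ≤ (p.2 - q.2) (p.1 - q.1)

/-- Quasidensity. The infimum is taken in the extended reals, so that it is the true infimum. -/
def IsQuasidense (S : E → Set (StrongDual ℝ E)) : Prop :=
  ∀ (x : E) (x' : StrongDual ℝ E),
    (⨅ p ∈ graph S, (((1 / 2 : ℝ) * ‖p.1 - x‖ ^ 2 + (1 / 2 : ℝ) * ‖p.2 - x'‖ ^ 2
      + (p.2 - x') (p.1 - x) : ℝ) : EReal)) ≤ 0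

/-- A subset of the dual `E*` is compact for the weak* topology `w(E*, E)`. -/
def IsWeakStarCompact (W : Set (StrongDual ℝ E)) : Prop :=
  IsCompact (StrongDual.toWeakDual '' W)

end Multifunction

/-! (b) gives (a) by taking singletons. For the converse, translate to the origin, let `h` be the
support function of `-W` and `k(x, x') = ‖x‖²/2 + h(x) + dist(x', W)²/2`. It suffices to find `b` at
which the Fitzpatrick function of the graph plus `k` is nearly nonpositive
(`exists_fitzpatrick_add_lt`): quasidensity at `b` then yields a graph point near `b`, since Young's
inequality makes the remaining terms nonnegative. If no such `b` exists, a continuous affine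
function with linear part `(y, z)` separates `-k` from the Fitzpatrick function. This is impossible:
type (NI) (`exists_sub_lt`) and the bound on the conjugate of `k` (`exists_half_sq_norm_add_le`)
both compare with `z y`, from opposite sides. -/

open Set Metric

/-! ### Convex separation and distance functions -/

section Separation

variable {V : Type*} [NormedAddCommGroup V] [NormedSpace ℝ V]

/-- Sandwich form of the Hahn–Banach theorem: a continuous affine function fits between the
concave function `-k` and a convex set lying above its graph. -/
theorem exists_affine_between {k : V → ℝ} (hk : ConvexOn ℝ univ k) (hkc : Continuous k)
    {C : Set (V × ℝ)} (hC : Convex ℝ C) (hCne : C.Nonempty) (h : ∀ p ∈ C, -k p.1 ≤ p.2) :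
    ∃ (f : StrongDual ℝ V) (u : ℝ), (∀ v, -k v ≤ f v + u) ∧ ∀ p ∈ C, f p.1 + u ≤ p.2 := by
  have hD : Convex ℝ {p : V × ℝ | p.2 < -k p.1} := by
    simpa using hk.neg.convex_strict_hypograph
  have hDo : IsOpen {p : V × ℝ | p.2 < -k p.1} :=
    isOpen_lt continuous_snd (hkc.comp continuous_fst).neg
  obtain ⟨F, u, hFD, hFC⟩ := geometric_hahn_banach_open hD hDo hC
    (Set.disjoint_left.2 fun p hp hpC => absurd (h p hpC) (not_le.2 hp))
  have hF : ∀ (v : V) (t : ℝ), F (v, t) = F (v, 0) + t * F (0, 1) := by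
    intro v t
    have : ((v, t) : V × ℝ) = (v, 0) + t • (0, 1) := by simp
    rw [this, map_add, map_smul, smul_eq_mul]
  obtain ⟨⟨v₀, t₀⟩, h₀⟩ := hCne
  set c := F (0, 1) with hc
  -- The separating hyperplane is not vertical, because `k` is finite at `v₀`.
  have hcpos : 0 < c := by
    have h1 := hFC _ h₀
    have h2 := hFD (v₀, -k v₀ - 1) (by simp)
    have h3 := h _ h₀
    rw [hF] at h1 h2
    simp only at h3
    by_contra! hle
    nlinarith
  have he : ∀ v, (-(c⁻¹ • F.comp (ContinuousLinearMap.inl ℝ V ℝ))) v + u / c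
      = (u - F (v, 0)) / c := fun v => by
    simp
    field_simp
    ring
  refine ⟨-(c⁻¹ • F.comp (ContinuousLinearMap.inl ℝ V ℝ)), u / c, fun v => ?_, fun p hp => ?_⟩
  · rw [he]
    refine le_of_forall_lt_imp_le_of_dense fun t ht => ?_
    have := hFD (v, t) ht
    rw [hF] at this
    rw [le_div_iff₀ hcpos]
    linarith
  · have := hFC p hp
    rw [← Prod.mk.eta (p := p), hF] at this
    rw [he, div_le_iff₀ hcpos]
    linarith

theorem convexOn_infDist {s : Set V} (hs : Convex ℝ s) (hne : s.Nonempty) :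
    ConvexOn ℝ univ fun x => infDist x s := by
  refine ⟨convex_univ, fun x _ y _ a b ha hb hab => ?_⟩
  refine le_of_forall_pos_le_add fun ε hε => ?_
  obtain ⟨u, hu, hxu⟩ := (infDist_lt_iff hne).1 (lt_add_of_pos_right (infDist x s) hε)
  obtain ⟨v, hv, hyv⟩ := (infDist_lt_iff hne).1 (lt_add_of_pos_right (infDist y s) hε)
  have h1 : infDist (a • x + b • y) s ≤ dist (a • x + b • y) (a • u + b • v) :=
    infDist_le_dist_of_mem (hs hu hv ha hb hab)
  have h2 : dist (a • x + b • y) (a • u + b • v) ≤ a * dist x u + b * dist y v := by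
    refine (dist_add_add_le _ _ _ _).trans_eq ?_
    rw [dist_smul₀, dist_smul₀, Real.norm_of_nonneg ha, Real.norm_of_nonneg hb]
  simp only [smul_eq_mul]
  have h3 : a * dist x u ≤ a * (infDist x s + ε) := by gcongr
  have h4 : b * dist y v ≤ b * (infDist y s + ε) := by gcongr
  have h5 : a * ε + b * ε = ε := by rw [← add_mul, hab, one_mul]
  linarith

end Separation

/-! ### Weak* compact convex sets -/

namespace Multifunction

variable {E : Type*} [NormedAddCommGroup E] [NormedSpace ℝ E] {W : Set (StrongDual ℝ E)}

/-- Uniform boundedness principle; this is where completeness of `E` enters. -/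
theorem IsWeakStarCompact.exists_norm_le [CompleteSpace E] (hW : IsWeakStarCompact W) :
    ∃ M, 0 ≤ M ∧ ∀ w ∈ W, ‖w‖ ≤ M := by
  have hb : Bornology.IsBounded W := by
    have := WeakDual.isBounded_iff_isVonNBounded.2 (hW.isVonNBounded ℝ)
    rw [← WeakDual.isBounded_toWeakDual_preimage_iff_isBounded] at this
    rwa [preimage_image_eq _ StrongDual.toWeakDual.injective] at this
  obtain ⟨M, hM, h⟩ := hb.exists_pos_norm_le
  exact ⟨M, hM.le, h⟩

theorem IsWeakStarCompact.exists_isMinOn_eval (hW : IsWeakStarCompact W) (hne : W.Nonempty)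
    (x : E) : ∃ w ∈ W, ∀ v ∈ W, w x ≤ v x := by
  obtain ⟨_, ⟨w, hw, rfl⟩, h⟩ := hW.exists_isMinOn (hne.image _)
    (WeakDual.eval_continuous x).continuousOn
  exact ⟨w, hw, fun v hv => h (mem_image_of_mem _ hv)⟩

/-- A convex weak* compact set is separated by a vector of `E` from any point at distance more
than `r`. -/
theorem IsWeakStarCompact.exists_norm_eq_of_lt_infDist (hW : IsWeakStarCompact W)
    (hne : W.Nonempty) (hconv : Convex ℝ W) (y : StrongDual ℝ E) {r : ℝ} (hr : 0 ≤ r)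
    (hlt : r < infDist y W) : ∃ x : E, ‖x‖ = r ∧ ∀ w ∈ W, (y - w) x ≤ -(r * r) := by
  have hB := WeakDual.isCompact_closedBall (𝕜 := ℝ) y r
  have hBc : Convex ℝ (WeakDual.toStrongDual (𝕜 := ℝ) (E := E) ⁻¹' closedBall y r) :=
    (convex_closedBall y r).linear_preimage (WeakDual.toStrongDual (𝕜 := ℝ) (E := E)).toLinearMap
  have hWc : Convex ℝ (StrongDual.toWeakDual '' W) :=
    hconv.linear_image (StrongDual.toWeakDual (𝕜 := ℝ) (E := E)).toLinearMap
  have hdisj : Disjoint (WeakDual.toStrongDual (𝕜 := ℝ) (E := E) ⁻¹' closedBall y r)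
      (StrongDual.toWeakDual '' W) := by
    rw [Set.disjoint_left]
    rintro _ hp ⟨w, hw, rfl⟩
    have h1 : dist w y ≤ r := hp
    rw [dist_comm] at h1
    exact absurd (infDist_le_dist_of_mem hw) (not_le.2 (h1.trans_lt hlt))
  have : LocallyConvexSpace ℝ (WeakDual ℝ E) :=
    inferInstanceAs (LocallyConvexSpace ℝ (WeakBilin (topDualPairing ℝ E)))
  obtain ⟨F, u, v, hFB, huv, hFW⟩ :=
    geometric_hahn_banach_compact_closed hBc hB hWc hW.isClosed hdisj
  obtain ⟨x, hx⟩ := LinearMap.dualEmbedding_surjective (topDualPairing ℝ E) F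
  have hFx : ∀ z : StrongDual ℝ E, F (StrongDual.toWeakDual z) = z x := fun z => by
    rw [← hx]; rfl
  have hsep : ∀ w ∈ W, (y - w) x < -(r * ‖x‖) := by
    -- Testing on `y + r • g`, with `g` norming `x`, reaches the supremum of `x` over the ball.
    intro w hw
    obtain ⟨g, hg, hgx⟩ := exists_dual_vector'' ℝ x
    have h1 := hFB (StrongDual.toWeakDual (y + r • g)) (by
      simp [norm_smul, abs_of_nonneg hr]
      nlinarith)
    have h2 := hFW _ (mem_image_of_mem _ hw)
    rw [hFx] at h1 h2
    simp at h1 hgx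
    rw [hgx] at h1
    rw [sub_apply]
    linarith
  have hx0 : 0 < ‖x‖ := by
    rw [norm_pos_iff]
    rintro rfl
    obtain ⟨w, hw⟩ := hne
    simpa using hsep w hw
  refine ⟨(r / ‖x‖) • x, ?_, fun w hw => ?_⟩
  · rw [norm_smul, Real.norm_of_nonneg (by positivity)]
    field_simp
  · rw [map_smul, smul_eq_mul]
    calc _ ≤ r / ‖x‖ * (-(r * ‖x‖)) := by
          gcongr
          exact (hsep w hw).le
      _ = _ := by field_simp

/-- A separating vector of norm `r` makes the left side at most `r²/2 - r²`; let `r` approach the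
distance. One `x` serves all `w`, as in a minimax theorem. -/
theorem IsWeakStarCompact.exists_half_sq_norm_add_le (hW : IsWeakStarCompact W)
    (hne : W.Nonempty) (hconv : Convex ℝ W) (y : StrongDual ℝ E) {ε : ℝ} (hε : 0 < ε) :
    ∃ x : E, ∀ w ∈ W, 1 / 2 * ‖x‖ ^ 2 + (y - w) x ≤ -(1 / 2 * infDist y W ^ 2) + ε := by
  rcases (infDist_nonneg (x := y) (s := W)).eq_or_lt with h0 | h0
  · refine ⟨0, fun w _ => ?_⟩
    rw [← h0]
    simpa using hε.le
  · set d := infDist y W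
    have hlt : max 0 (d - ε / d) < d := max_lt h0 (by linarith [div_pos hε h0])
    obtain ⟨x, hx, h⟩ := hW.exists_norm_eq_of_lt_infDist hne hconv y (le_max_left _ _) hlt
    refine ⟨x, fun w hw => ?_⟩
    have h1 := h w hw
    rw [hx]
    set r := max 0 (d - ε / d)
    have h2 : d - ε / d ≤ r := le_max_right _ _
    have h3 : 0 ≤ r := le_max_left _ _
    have h4 : d * (d - ε / d) = d * d - ε := by field_simp
    nlinarith

/-! ### Quasidensity, type (NI) and the Fitzpatrick function -/

/-- Quasidensity of a subset of `E × E*`, in terms of approximating points. -/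
def QuasidenseSet (G : Set (E × StrongDual ℝ E)) : Prop :=
  ∀ (x : E) (x' : StrongDual ℝ E) (ε : ℝ), 0 < ε → ∃ p ∈ G,
    1 / 2 * ‖p.1 - x‖ ^ 2 + 1 / 2 * ‖p.2 - x'‖ ^ 2 + (p.2 - x') (p.1 - x) < ε

theorem isQuasidense_iff_quasidenseSet {S : E → Set (StrongDual ℝ E)} :
    IsQuasidense S ↔ QuasidenseSet (graph S) := by
  refine forall₂_congr fun x x' => ⟨fun h ε hε => ?_, fun h => ?_⟩
  · have h1 := h.trans_lt (EReal.coe_pos.2 hε)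
    simp only [iInf_lt_iff] at h1
    obtain ⟨p, hp, h2⟩ := h1
    exact ⟨p, hp, EReal.coe_lt_coe_iff.1 h2⟩
  · refine EReal.le_of_forall_lt_iff_le.1 fun ε hε => ?_
    obtain ⟨p, hp, h1⟩ := h ε (by exact_mod_cast hε)
    exact (iInf₂_le p hp).trans (EReal.coe_le_coe_iff.2 h1.le)

variable {G : Set (E × StrongDual ℝ E)}

/-- A quasidense set is of type (NI). -/
theorem QuasidenseSet.exists_sub_lt (hG : QuasidenseSet G) (y : StrongDual ℝ E)
    (z : StrongDual ℝ (StrongDual ℝ E)) {ε : ℝ} (hε : 0 < ε) :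
    ∃ p ∈ G, z y - ε < y p.1 + z p.2 - p.2 p.1 := by
  obtain ⟨v, hv, hzv⟩ : ∃ v : StrongDual ℝ E, ‖v‖ ≤ ‖z‖ ∧ ‖z‖ * ‖z‖ - ε / 2 ≤ z v := by
    rcases (norm_nonneg z).eq_or_lt with h0 | h0
    · exact ⟨0, by rw [norm_zero]; exact h0.le, by rw [← h0]; simp; positivity⟩
    · obtain ⟨v, hv, hzv⟩ := z.exists_lt_apply_of_lt_opNorm
        (show ‖z‖ - ε / 2 / ‖z‖ < ‖z‖ by linarith [div_pos (half_pos hε) h0])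
      obtain ⟨v', hv', hzv'⟩ : ∃ v' : StrongDual ℝ E, ‖v'‖ < 1 ∧ ‖z‖ - ε / 2 / ‖z‖ < z v' := by
        rcases lt_abs.1 hzv with h | h
        · exact ⟨v, hv, h⟩
        · exact ⟨-v, by rwa [norm_neg], by rwa [map_neg]⟩
      refine ⟨‖z‖ • v', ?_, ?_⟩
      · rw [norm_smul, Real.norm_of_nonneg h0.le]
        exact mul_le_of_le_one_right h0.le hv'.le
      · rw [map_smul, smul_eq_mul]
        calc ‖z‖ * ‖z‖ - ε / 2 = ‖z‖ * (‖z‖ - ε / 2 / ‖z‖) := by field_simp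
          _ ≤ _ := by gcongr
  -- Shifting `y` by the near-norming `v` supplies `‖z‖²`, which completes both squares below.
  obtain ⟨⟨s, s'⟩, hp, h⟩ := hG 0 (y + v) (ε / 2) (by positivity)
  refine ⟨_, hp, ?_⟩
  simp only [sub_zero] at h
  set d := s' - (y + v) with hd
  have hs' : s' = y + v + d := by rw [hd]; abel
  simp only [hs', map_add, add_apply]
  have h1 : -(‖z‖ * ‖d‖) ≤ z d := (abs_le.1 (z.le_opNorm d)).1
  have h2 : v s ≤ ‖z‖ * ‖s‖ := ((le_abs_self _).trans (v.le_opNorm s)).trans (by gcongr)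
  nlinarith [sq_nonneg (‖z‖ - ‖d‖), sq_nonneg (‖z‖ - ‖s‖)]

/-- Existence of an approximate minimizer of the sum of the Fitzpatrick function of `G` and a
convex function whose conjugate is controlled. -/
theorem QuasidenseSet.exists_fitzpatrick_add_lt (hG : QuasidenseSet G)
    (hmono : ∀ p ∈ G, ∀ q ∈ G, 0 ≤ (p.2 - q.2) (p.1 - q.1))
    {k : E × StrongDual ℝ E → ℝ} (hk : ConvexOn ℝ univ k) (hkc : Continuous k)
    (hconj : ∀ (y : StrongDual ℝ E) (z : StrongDual ℝ (StrongDual ℝ E)) (ε : ℝ), 0 < ε →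
      ∃ b : E × StrongDual ℝ E, k b + y b.1 + z b.2 ≤ z y + ε) {ε : ℝ} (hε : 0 < ε) :
    ∃ b : E × StrongDual ℝ E, ∀ p ∈ G, p.2 b.1 + b.2 p.1 - p.2 p.1 + k b < ε := by
  by_contra! hcon
  -- The epigraph of the Fitzpatrick function; monotonicity puts the graph points, at height `p.2
  -- p.1`, in it.
  set C : Set ((E × StrongDual ℝ E) × ℝ) :=
    {c | ∀ p ∈ G, p.2 c.1.1 + c.1.2 p.1 - p.2 p.1 ≤ c.2} with hC
  have hCconv : Convex ℝ C := by
    intro c hc e he a b ha hb hab p hp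
    have h1 := mul_le_mul_of_nonneg_left (hc p hp) ha
    have h2 := mul_le_mul_of_nonneg_left (he p hp) hb
    have h3 : a * p.2 p.1 + b * p.2 p.1 = p.2 p.1 := by rw [← add_mul, hab, one_mul]
    simp
    linarith
  have hmem : ∀ p ∈ G, ((p, p.2 p.1) : (E × StrongDual ℝ E) × ℝ) ∈ C := by
    intro p hp q hq
    have := hmono p hp q hq
    simp only [map_sub, sub_apply] at this ⊢
    linarith
  obtain ⟨p₀, hp₀, -⟩ := hG 0 0 1 one_pos
  obtain ⟨f, u, hfk, hfC⟩ := exists_affine_between (k := fun b => k b + -ε)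
    (hk.add_const _) (by fun_prop) hCconv ⟨_, hmem p₀ hp₀⟩ (by
      intro c hc
      obtain ⟨p, hp, h⟩ := hcon c.1
      have := hc p hp
      linarith)
  set y := f.comp (ContinuousLinearMap.inl ℝ E (StrongDual ℝ E))
  set z := f.comp (ContinuousLinearMap.inr ℝ E (StrongDual ℝ E))
  have hf : ∀ b : E × StrongDual ℝ E, f b = y b.1 + z b.2 := fun b => by
    simp [y, z, ← map_add]
  obtain ⟨p, hp, h1⟩ := hG.exists_sub_lt y z (ε := ε / 4) (by positivity)
  obtain ⟨b, hb⟩ := hconj y z (ε / 4) (by positivity)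
  have h2 := hfC _ (hmem p hp)
  have h3 := hfk b
  rw [hf] at h2 h3
  simp only at h2 h3
  linarith

/-! ### The fuzzy criterion -/

/-- Fuzzy criterion for quasidensity, centred at the origin of `E`. -/
theorem QuasidenseSet.exists_isGreatest_lt [CompleteSpace E] (hG : QuasidenseSet G)
    (hmono : ∀ p ∈ G, ∀ q ∈ G, 0 ≤ (p.2 - q.2) (p.1 - q.1)) (hne : W.Nonempty)
    (hW : IsWeakStarCompact W) (hconv : Convex ℝ W) {η : ℝ} (hη : 0 < η) :
    ∃ p ∈ G, ∃ m : ℝ, IsGreatest ((fun w : StrongDual ℝ E => (p.2 - w) p.1) '' W) m ∧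
      1 / 2 * ‖p.1‖ ^ 2 + 1 / 2 * infDist p.2 W ^ 2 + m < η := by
  obtain ⟨M, hM, hWM⟩ := hW.exists_norm_le
  choose φ hφW hφ using hW.exists_isMinOn_eval hne
  set h : E → ℝ := fun x => -(φ x) x with hh
  have hle : ∀ x, ∀ w ∈ W, -w x ≤ h x := fun x w hw => neg_le_neg (hφ x w hw)
  have hlip : ∀ x y, h x ≤ h y + M * ‖x - y‖ := by
    intro x y
    have h1 := hle y (φ x) (hφW x)
    have h2 : -(φ x) (x - y) ≤ M * ‖x - y‖ := ((neg_le_abs _).trans ((φ x).le_opNorm _)).trans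
      (by gcongr; exact hWM _ (hφW x))
    rw [map_sub] at h2
    simp only [hh] at h1 ⊢
    linarith
  have hcont : Continuous h :=
    (LipschitzWith.of_le_add_mul ⟨M, hM⟩ fun x y => by
      rw [dist_eq_norm]; exact hlip x y : LipschitzWith ⟨M, hM⟩ h).continuous
  have hconvex : ConvexOn ℝ univ h := by
    refine ⟨convex_univ, fun x _ y _ a b ha hb _ => ?_⟩
    have h1 := mul_le_mul_of_nonneg_left (hle x _ (hφW (a • x + b • y))) ha
    have h2 := mul_le_mul_of_nonneg_left (hle y _ (hφW (a • x + b • y))) hb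
    have h3 : h (a • x + b • y)
        = a * -(φ (a • x + b • y)) x + b * -(φ (a • x + b • y)) y := by
      simp only [hh, map_add, map_smul, smul_eq_mul]
      ring
    rw [h3]
    exact add_le_add h1 h2
  have hyoung : ∀ (x : E) (x' : StrongDual ℝ E), -(infDist x' W * ‖x‖) ≤ x' x + h x := by
    intro x x'
    refine neg_le.1 (le_of_forall_pos_le_add fun ε hε => ?_)
    obtain ⟨w, hw, hd⟩ := (infDist_lt_iff hne).1
      (lt_add_of_pos_right (infDist x' W) (show 0 < ε / (‖x‖ + 1) by positivity))
    have h1 : -(x' - w) x ≤ dist x' w * ‖x‖ := by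
      rw [dist_eq_norm]
      exact (neg_le_abs _).trans ((x' - w).le_opNorm x)
    have h2 : dist x' w * ‖x‖ ≤ (infDist x' W + ε / (‖x‖ + 1)) * ‖x‖ := by gcongr
    have h3 : ε / (‖x‖ + 1) * ‖x‖ ≤ ε := by
      rw [div_mul_eq_mul_div, div_le_iff₀ (by positivity)]
      nlinarith
    have h4 := hle x w hw
    rw [sub_apply] at h1
    linarith
  have hnorm : ∀ x' : StrongDual ℝ E, ‖x'‖ ≤ infDist x' W + M := by
    intro x'
    refine le_of_forall_pos_le_add fun ε hε => ?_
    obtain ⟨w, hw, hd⟩ := (infDist_lt_iff hne).1 (lt_add_of_pos_right (infDist x' W) hε)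
    rw [dist_eq_norm] at hd
    linarith [hWM w hw, norm_le_norm_sub_add x' w]
  set k : E × StrongDual ℝ E → ℝ :=
    fun b => 1 / 2 * ‖b.1‖ ^ 2 + h b.1 + 1 / 2 * infDist b.2 W ^ 2 with hk
  have hkc : Continuous k := by
    have := continuous_infDist_pt W
    fun_prop
  have hkconv : ConvexOn ℝ univ k := by
    have h1 : ConvexOn ℝ univ fun x : E => (1 / 2 : ℝ) • ‖x‖ ^ 2 :=
      (convexOn_univ_norm.pow (fun _ _ => norm_nonneg _) 2).smul (by norm_num)
    have h2 : ConvexOn ℝ univ fun x : StrongDual ℝ E => (1 / 2 : ℝ) • infDist x W ^ 2 :=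
      ((convexOn_infDist hconv hne).pow (fun _ _ => infDist_nonneg) 2).smul (by norm_num)
    exact ((h1.add hconvex).comp_linearMap (LinearMap.fst ℝ E (StrongDual ℝ E))).add
      (h2.comp_linearMap (LinearMap.snd ℝ E (StrongDual ℝ E)))
  have hconj : ∀ (y : StrongDual ℝ E) (z : StrongDual ℝ (StrongDual ℝ E)) (ε : ℝ), 0 < ε →
      ∃ b : E × StrongDual ℝ E, k b + y b.1 + z b.2 ≤ z y + ε := by
    intro y z ε hε
    obtain ⟨x, hx⟩ := hW.exists_half_sq_norm_add_le hne hconv y hε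
    refine ⟨(x, y), ?_⟩
    have := hx _ (hφW x)
    rw [sub_apply] at this
    simp only [hk, hh]
    linarith
  -- One fixed graph point bounds `X` and `D` by `R` independently of `δ`, so `δ` may be chosen from
  -- `R` in advance.
  obtain ⟨⟨a, a'⟩, ha, -⟩ := hG 0 0 1 one_pos
  set K := M + ‖a‖ + ‖a'‖ with hK
  have hK0 : 0 ≤ K := by positivity
  set R := 4 * K + 2 with hR
  set L := 4 * R + 2 * M + 3 with hL
  have hL0 : 0 < L := by positivity
  obtain ⟨δ, hδ0, hδ1, hδη⟩ : ∃ δ : ℝ, 0 < δ ∧ δ ≤ 1 ∧ δ * L ≤ η :=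
    ⟨min 1 (η / L), by positivity, min_le_left _ _,
      (le_div_iff₀ hL0).1 (min_le_right _ _)⟩
  obtain ⟨⟨x, x'⟩, hb⟩ := hG.exists_fitzpatrick_add_lt hmono hkconv hkc hconj
    (ε := δ ^ 2 / 4) (by positivity)
  set X := ‖x‖ with hX
  set D := infDist x' W with hD
  have hX0 : 0 ≤ X := norm_nonneg _
  have hD0 : 0 ≤ D := infDist_nonneg
  have hδ2 : δ ^ 2 ≤ 1 := pow_le_one₀ hδ0.le hδ1
  have hsq : (X - K) ^ 2 + (D - K) ^ 2 ≤ (3 * K + 2) ^ 2 := by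
    have h1 := hb _ ha
    simp only [hk] at h1
    have h2 : -(‖a'‖ * X) ≤ a' x := (abs_le.1 (a'.le_opNorm x)).1
    have h3 : -((D + M) * ‖a‖) ≤ x' a := by
      have h5 : ‖x'‖ * ‖a‖ ≤ (D + M) * ‖a‖ := by gcongr; exact hnorm x'
      linarith [(abs_le.1 (x'.le_opNorm a)).1]
    have h4 : a' a ≤ ‖a'‖ * ‖a‖ := (le_abs_self _).trans (a'.le_opNorm a)
    have h5 : -(M * X) ≤ h x := by
      have h6 : ‖φ x‖ * X ≤ M * X := by gcongr; exact hWM _ (hφW x)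
      have := (le_abs_self _).trans ((φ x).le_opNorm x)
      simp only [hh]
      linarith
    have h7 : (M + ‖a'‖) * X ≤ K * X := by gcongr; linarith [norm_nonneg a]
    have h8 : ‖a‖ * D ≤ K * D := by gcongr; linarith [norm_nonneg a']
    have h9 : M * ‖a‖ ≤ K * K := by
      gcongr <;> linarith [norm_nonneg a, norm_nonneg a']
    have h10 : ‖a'‖ * ‖a‖ ≤ K * K := by
      gcongr <;> linarith [norm_nonneg a, norm_nonneg a']
    linarith [mul_nonneg hK0 hK0]
  have hXR : X ≤ R := by
    have := abs_le_of_sq_le_sq' (by linarith [sq_nonneg (D - K)] :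
      (X - K) ^ 2 ≤ (3 * K + 2) ^ 2) (by positivity)
    linarith [this.2]
  have hDR : D ≤ R := by
    have := abs_le_of_sq_le_sq' (by linarith [sq_nonneg (X - K)] :
      (D - K) ^ 2 ≤ (3 * K + 2) ^ 2) (by positivity)
    linarith [this.2]
  obtain ⟨⟨s, s'⟩, hs, hsx⟩ := hG x x' (δ ^ 2 / 4) (by positivity)
  have hbs := hb _ hs
  simp only [hk] at hbs hsx
  have hpair : (s' - x') (s - x) = s' s - s' x - x' s + x' x := by
    simp only [map_sub, sub_apply]
    ring
  have hY := hyoung x x'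
  -- Adding `hbs` and `hsx` cancels the mixed pairings; by `hY`, what remains besides the two
  -- squares is at least `(X - D)²/2`.
  have hd : ‖s - x‖ ^ 2 + ‖s' - x'‖ ^ 2 ≤ δ ^ 2 := by
    linarith [sq_nonneg (X - D)]
  have hd1 : ‖s - x‖ ≤ δ := (abs_le_of_sq_le_sq' (by linarith [sq_nonneg ‖s' - x'‖]) hδ0.le).2
  have hd2 : ‖s' - x'‖ ≤ δ := (abs_le_of_sq_le_sq' (by linarith [sq_nonneg ‖s - x‖]) hδ0.le).2
  refine ⟨(s, s'), hs, s' s + h s, ⟨⟨φ s, hφW s, by simp [hh, sub_eq_add_neg]⟩, ?_⟩, ?_⟩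
  · rintro _ ⟨w, hw, rfl⟩
    have := hle s w hw
    simp only [sub_apply]
    linarith
  · simp only
    have h1 : ‖s‖ ^ 2 ≤ (X + δ) ^ 2 := by
      gcongr
      linarith [norm_le_norm_sub_add s x]
    have h2 : infDist s' W ^ 2 ≤ (D + δ) ^ 2 := by
      gcongr
      · exact infDist_nonneg
      · have := infDist_le_infDist_add_dist (s := W) (x := s') (y := x')
        rw [dist_eq_norm] at this
        linarith
    have h3 : h s ≤ h x + M * δ := (hlip s x).trans (by gcongr)
    have h4 : (s' - x') x ≤ δ * X :=
      ((le_abs_self _).trans ((s' - x').le_opNorm x)).trans (by gcongr)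
    have h5 : x' (s - x) ≤ (D + M) * δ :=
      ((le_abs_self _).trans (x'.le_opNorm _)).trans (by gcongr; exact hnorm x')
    rw [sub_apply] at h4
    rw [map_sub] at h5
    have h6 : δ * X ≤ δ * R := by gcongr
    have h7 : δ * D ≤ δ * R := by gcongr
    have h8 : 0 ≤ ‖s - x‖ ^ 2 := by positivity
    have h9 : 0 ≤ ‖s' - x'‖ ^ 2 := by positivity
    have h10 : δ ^ 2 ≤ δ := by
      rw [sq]
      exact mul_le_of_le_one_left hδ0.le hδ1
    have h11 : δ * L = 4 * (δ * R) + 2 * (M * δ) + 3 * δ := by rw [hL]; ring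
    linarith [show (X + δ) ^ 2 = X ^ 2 + 2 * (δ * X) + δ ^ 2 by ring,
      show (D + δ) ^ 2 = D ^ 2 + 2 * (δ * D) + δ ^ 2 by ring,
      show (D + M) * δ = δ * D + M * δ by ring]

theorem QuasidenseSet.translate (hG : QuasidenseSet G) (w : E) :
    QuasidenseSet {p : E × StrongDual ℝ E | (p.1 + w, p.2) ∈ G} := by
  intro x x' ε hε
  obtain ⟨⟨s, s'⟩, hs, h⟩ := hG (x + w) x' ε hε
  refine ⟨(s - w, s'), by simpa using hs, ?_⟩
  simpa only [sub_sub, add_comm w x] using h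

end Multifunction

theorem mainTheorem7 {E : Type*} [NormedAddCommGroup E] [NormedSpace ℝ E] [CompleteSpace E]
    [Nontrivial E] (S : E → Set (StrongDual ℝ E))
    (hne : (Multifunction.graph S).Nonempty)
    (hclosed : Multifunction.IsClosedGraph S) (hmono : Multifunction.IsMonotone S) :
    Multifunction.IsQuasidense S ↔
      ∀ (w : E) (W : Set (StrongDual ℝ E)), W.Nonempty → Multifunction.IsWeakStarCompact W →
        Convex ℝ W → ∀ η : ℝ, 0 < η →
          ∃ s : E, ∃ s' : StrongDual ℝ E, (s, s') ∈ Multifunction.graph S ∧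
            ∃ m : ℝ, IsGreatest ((fun w' : StrongDual ℝ E => (s' - w') (s - w)) '' W) m ∧
              (1 / 2 : ℝ) * ‖s - w‖ ^ 2 + (1 / 2 : ℝ) * Metric.infDist s' W ^ 2 + m < η := by
  rw [Multifunction.isQuasidense_iff_quasidenseSet]
  constructor
  · intro hq w W hWne hW hWc η hη
    obtain ⟨⟨s, s'⟩, hs, m, hm, hlt⟩ := (hq.translate w).exists_isGreatest_lt
      (fun p hp q hq => by simpa using hmono _ hp _ hq) hWne hW hWc hη
    exact ⟨s + w, s', hs, m, by simpa using hm, by simpa using hlt⟩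
  · intro h x x' ε hε
    obtain ⟨s, s', hs, m, hm, hlt⟩ := h x {x'} (singleton_nonempty _)
      (by simp [Multifunction.IsWeakStarCompact]) (convex_singleton _) ε hε
    obtain ⟨w, hw, rfl⟩ := hm.1
    obtain rfl : w = x' := hw
    exact ⟨(s, s'), hs, by simpa [dist_eq_norm] using hlt⟩
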